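/- For a prime $p$ and an integer $m\ge 1$, let $\lambda_{p,m}$ denote the least common multiple of the multiplicative orders modulo $p$ of the first $m$ primes (if $p$ is itself among the first $m$ primes, it is omitted, and an empty least common multiple is $1$). For every integer $m\ge 1$ there is a constant $C_m>0$, depending only on $m$, such that for all real $\theta$ with $0<\theta<1$ and all real $x\ge 2$, $$\sum_{\substack{p\ \mathrm{prime}\\ x^{\theta}<p\le x}} \frac{1}{p\,\lambda_{p,m}} \;\le\; \frac{C_m}{x^{\theta-1/(m+1)}\,\log x}.$$ -/

import Mathlib

/-- `lambdaPrime p m` is the number `λ_{p,m}`: for a prime `p`, the least common multiple of the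
multiplicative orders modulo `p` of the first `m` primes. If `p` itself is one of the first `m`
primes, it has no multiplicative order modulo `p`, and it is left out.
(`Nat.nth Nat.Prime i` is the prime with index `i`, starting with `2` at `i = 0`.) -/
noncomputable def lambdaPrime (p m : ℕ) : ℕ :=
  ((Finset.range m).filter (fun i => Nat.nth Nat.Prime i ≠ p)).lcm
    (fun i => orderOf ((Nat.nth Nat.Prime i : ℕ) : ZMod p))

/-!
The factor `1 / p` is at most `x ^ (-θ)`, so it is enough to show that the sum of `1 / λ_{p,m}` over
all primes `p ≤ x` is `O(y / log x)` with `y = x ^ (1 / (m + 1))`; this is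
`exists_sum_one_div_lambdaPrime_le`. Write `q₁, …, qₘ` for the first `m` primes and `Q` for their
product. Three kinds of primes contribute.

* The primes up to `w = Q √y` contribute at most `w`, because `λ_{p,m} ≥ 1`.
* The primes with `λ_{p,m} ≥ y ^ m = x / y` contribute at most `π(x) y / x`, which Chebyshev's
  bound (`primeCounting_floor_le`) makes `O(y / log x)`.
* For any other `p`, the `qᵢ` are `λ_{p,m}`-th roots of unity in the field `ZMod p`, which has at
  most `λ_{p,m}` of these. By the pigeonhole principle some nonzero integer vector `v`, of sup norm
  `h` with `h ^ m ≤ λ_{p,m}`, satisfies `∏ qᵢ ^ vᵢ = 1` modulo `p` (`exists_dvd_powDiff`), and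
  `h ≤ y`. Then `p` divides the difference `powDiff` of the numerator and the denominator of
  `∏ qᵢ ^ vᵢ`, which is nonzero by unique factorization and at most `Q ^ h` in absolute value.
  Hence this difference has at most `h log Q / log w` prime divisors above `w`, and there are
  `O(h ^ (m - 1))` vectors of sup norm `h`. As `1 / λ_{p,m} ≤ h ^ (-m)`, each `h ≤ y` contributes
  `O(1 / log w) = O(1 / log x)` (`sum_supShell_card_le`).

The cut-off `w` supplies the factor `1 / log x`: it is small enough to be negligible next to
`y / log x`, while `log w` is still comparable to `log x`.
-/

/-! ### Multiplicative relations between primes -/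

/-- The multiplicity of `q j` in a product of powers of distinct primes `q i` is its exponent. -/
theorem factorization_prod_prime_pow {ι : Type*} [Fintype ι] {q : ι → ℕ}
    (hq : ∀ i, (q i).Prime) (hinj : Function.Injective q) (e : ι → ℕ) (j : ι) :
    (∏ i, q i ^ e i).factorization (q j) = e j := by
  classical
  rw [Nat.factorization_prod fun i _ => pow_ne_zero _ (hq i).ne_zero, Finsupp.finsetSum_apply,
    Finset.sum_eq_single j]
  · simp [(hq j).factorization_self]
  · intro i _ hij
    simp [(hq i).factorization, hinj.ne hij]
  · simp

/-- For an integer vector `v`, the difference of the numerator and the denominator of the rational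
number `∏ i, q i ^ v i`, written as `∏ i, q i ^ v⁺ i - ∏ i, q i ^ v⁻ i`. A prime dividing none of
the `q i` divides it exactly when `∏ i, q i ^ v i` is `1` modulo that prime. -/
def powDiff {ι : Type*} [Fintype ι] (q : ι → ℕ) (v : ι → ℤ) : ℤ :=
  ∏ i, (q i : ℤ) ^ (v i).toNat - ∏ i, (q i : ℤ) ^ (-v i).toNat

theorem powDiff_ne_zero {ι : Type*} [Fintype ι] {q : ι → ℕ} (hq : ∀ i, (q i).Prime)
    (hinj : Function.Injective q) {v : ι → ℤ} (hv : v ≠ 0) : powDiff q v ≠ 0 := by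
  intro h
  obtain ⟨j, hj⟩ := Function.ne_iff.1 hv
  have h' : ∏ i, q i ^ (v i).toNat = ∏ i, q i ^ (-v i).toNat := by
    rw [powDiff, sub_eq_zero] at h
    exact_mod_cast h
  have h1 := factorization_prod_prime_pow hq hinj (fun i => (v i).toNat) j
  rw [h', factorization_prod_prime_pow hq hinj (fun i => (-v i).toNat) j] at h1
  simp only [Pi.zero_apply] at hj
  omega

theorem abs_powDiff_le {ι : Type*} [Fintype ι] {q : ι → ℕ} (hq : ∀ i, 1 ≤ q i) {v : ι → ℤ}
    {h : ℕ} (hv : ∀ i, |v i| ≤ h) : |powDiff q v| ≤ ((∏ i, q i) ^ h : ℕ) := by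
  have key (e : ι → ℕ) (he : ∀ i, e i ≤ h) :
      ∏ i, (q i : ℤ) ^ e i ≤ ((∏ i, q i) ^ h : ℕ) := by
    rw [← Finset.prod_pow]
    exact_mod_cast Finset.prod_le_prod' fun i _ => Nat.pow_le_pow_right (hq i) (he i)
  have nonneg (e : ι → ℕ) : 0 ≤ ∏ i, (q i : ℤ) ^ e i :=
    Finset.prod_nonneg fun i _ => by positivity
  have bd (i : ι) := abs_le.1 (hv i)
  have h1 := key (fun i => (v i).toNat) fun i => by have := bd i; omega
  have h2 := key (fun i => (-v i).toNat) fun i => by have := bd i; omega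
  have h3 := nonneg fun i => (v i).toNat
  have h4 := nonneg fun i => (-v i).toNat
  rw [powDiff, abs_le]
  constructor <;> linarith

/-- A nonzero integer has few prime divisors above a given bound, because their product
divides it. -/
theorem card_mul_log_le_log_abs {n : ℤ} (hn : n ≠ 0) {w : ℝ} (hw : 1 < w) {s : Finset ℕ}
    (hs : ∀ p ∈ s, p.Prime ∧ w < p ∧ (p : ℤ) ∣ n) :
    (s.card : ℝ) * Real.log w ≤ Real.log |(n : ℝ)| := by
  have hdvd : ∏ p ∈ s, p ∣ n.natAbs :=
    Finset.prod_primes_dvd _ (fun p hp => (hs p hp).1.prime)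
      fun p hp => Int.natCast_dvd.1 (hs p hp).2.2
  have hle : ∏ p ∈ s, p ≤ n.natAbs := Nat.le_of_dvd (Int.natAbs_pos.2 hn) hdvd
  have hpow : w ^ s.card ≤ |(n : ℝ)| := by
    calc w ^ s.card = ∏ _p ∈ s, w := by rw [Finset.prod_const]
      _ ≤ ∏ p ∈ s, (p : ℝ) :=
        Finset.prod_le_prod (fun _ _ => by linarith) fun p hp => (hs p hp).2.1.le
      _ ≤ (n.natAbs : ℝ) := by rw [← Nat.cast_prod]; exact_mod_cast hle
      _ = |(n : ℝ)| := by rw [Nat.cast_natAbs, Int.cast_abs]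
  rw [← Real.log_pow]
  exact Real.log_le_log (by positivity) hpow

/-- The integer vectors whose largest coordinate has absolute value exactly `h`. -/
noncomputable def supShell (ι : Type*) [Fintype ι] [DecidableEq ι] (h : ℕ) : Finset (ι → ℤ) :=
  (Fintype.piFinset fun _ => Finset.Icc (-h : ℤ) h).filter fun v => ∃ i, |v i| = h

theorem card_supShell_le {ι : Type*} [Fintype ι] [DecidableEq ι] (h : ℕ) :
    (supShell ι h).card ≤ Fintype.card ι * (2 * (2 * h + 1) ^ (Fintype.card ι - 1)) := by
  -- The `i`-th face of the shell is a product of one two-element set and intervals.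
  let face (i : ι) : Finset (ι → ℤ) :=
    Fintype.piFinset fun j => if j = i then {(h : ℤ), -(h : ℤ)} else Finset.Icc (-h : ℤ) h
  have hsub : supShell ι h ⊆ Finset.univ.biUnion face := by
    intro v hv
    simp only [supShell, Finset.mem_filter, Fintype.mem_piFinset] at hv
    obtain ⟨hv, i, hi⟩ := hv
    simp only [Finset.mem_biUnion, Finset.mem_univ, true_and, face, Fintype.mem_piFinset]
    refine ⟨i, fun j => ?_⟩
    split_ifs with hj
    · subst hj
      simpa using (abs_eq (by positivity)).1 hi
    · exact hv j
  have hface (i : ι) : (face i).card ≤ 2 * (2 * h + 1) ^ (Fintype.card ι - 1) := by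
    rw [Fintype.card_piFinset, ← Finset.mul_prod_erase _ _ (Finset.mem_univ i), if_pos rfl]
    refine Nat.mul_le_mul Finset.card_le_two (le_of_eq ?_)
    rw [Finset.prod_congr rfl (g := fun _ => 2 * h + 1), Finset.prod_const,
      Finset.card_erase_of_mem (Finset.mem_univ i), Finset.card_univ]
    intro j hj
    rw [if_neg (Finset.ne_of_mem_erase hj), Int.card_Icc]
    omega
  calc (supShell ι h).card ≤ (Finset.univ.biUnion face).card := Finset.card_le_card hsub
    _ ≤ Finset.univ.card * (2 * (2 * h + 1) ^ (Fintype.card ι - 1)) :=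
      Finset.card_biUnion_le_card_mul _ _ _ fun i _ => hface i
    _ = _ := by rw [Finset.card_univ]

/-- If the `q i` are all `L`-th roots of unity modulo `p`, they satisfy a multiplicative relation
modulo `p` with exponents at most about `L ^ (1 / card ι)`: the field `ZMod p` has at most `L` such
roots, so that two of the products with exponents in `[0, A]` coincide once
`L < (A + 1) ^ card ι`. -/
theorem exists_dvd_powDiff {ι : Type*} [Fintype ι] [DecidableEq ι] [Nonempty ι] {p : ℕ}
    (hp : p.Prime) {q : ι → ℕ} (hq : ∀ i, (q i : ZMod p) ≠ 0) {L : ℕ} (hL : 0 < L)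
    (hqL : ∀ i, (q i : ZMod p) ^ L = 1) :
    ∃ h : ℕ, 1 ≤ h ∧ h ^ Fintype.card ι ≤ L ∧ ∃ v ∈ supShell ι h, (p : ℤ) ∣ powDiff q v := by
  have : Fact p.Prime := ⟨hp⟩
  have hι : Fintype.card ι ≠ 0 := Fintype.card_ne_zero
  -- `A` is the integer part of `L ^ (1 / card ι)`.
  obtain ⟨A, hAL, hLA⟩ : ∃ A, A ^ Fintype.card ι ≤ L ∧ L < (A + 1) ^ Fintype.card ι := by
    have hex : ∃ A, L < (A + 1) ^ Fintype.card ι :=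
      ⟨L, (Nat.lt_succ_self L).trans_le (Nat.le_self_pow hι _)⟩
    refine ⟨Nat.find hex, ?_, Nat.find_spec hex⟩
    rcases hA : Nat.find hex with _ | B
    · simp [hι]
    · exact not_lt.1 (Nat.find_min hex (m := B) (by omega))
  let f : (ι → ℕ) → ZMod p := fun a => ∏ i, (q i : ZMod p) ^ a i
  have hcard : (Polynomial.nthRootsFinset L (1 : ZMod p)).card <
      (Fintype.piFinset fun _ : ι => Finset.range (A + 1)).card := by
    rw [Fintype.card_piFinset]
    simp only [Finset.card_range, Finset.prod_const, Finset.card_univ]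
    refine lt_of_le_of_lt ?_ hLA
    exact (@Multiset.toFinset_card_le _ (_) _).trans (Polynomial.card_nthRoots L 1)
  obtain ⟨a, ha, b, hb, hab, hf⟩ := Finset.exists_ne_map_eq_of_card_lt_of_maps_to hcard
    (f := f) (fun a _ => by
      rw [Finset.mem_coe, Polynomial.mem_nthRootsFinset hL, ← Finset.prod_pow]
      exact Finset.prod_eq_one fun i _ => by rw [← pow_mul, mul_comm, pow_mul, hqL, one_pow])
  simp only [Fintype.mem_piFinset, Finset.mem_range] at ha hb
  let v : ι → ℤ := fun i => (a i : ℤ) - b i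
  obtain ⟨i₀, -, hi₀⟩ := Finset.exists_max_image Finset.univ (fun i => (v i).natAbs)
    Finset.univ_nonempty
  refine ⟨(v i₀).natAbs, ?_, ?_, v, ?_, ?_⟩
  · obtain ⟨j, hj⟩ := Function.ne_iff.1 hab
    have := hi₀ j (Finset.mem_univ j)
    simp only [v] at this ⊢
    omega
  · refine (Nat.pow_le_pow_left ?_ _).trans hAL
    have := ha i₀
    have := hb i₀
    simp only [v]
    omega
  · simp only [supShell, Finset.mem_filter, Fintype.mem_piFinset, Finset.mem_Icc]
    refine ⟨fun i => ?_, i₀, by simp⟩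
    have := hi₀ i (Finset.mem_univ i)
    omega
  · -- Cancel the common factor `∏ i, q i ^ min (a i) (b i)`.
    rw [← ZMod.intCast_zmod_eq_zero_iff_dvd]
    have hc : ∏ i, (q i : ZMod p) ^ min (a i) (b i) ≠ 0 :=
      Finset.prod_ne_zero_iff.2 fun i _ => pow_ne_zero _ (hq i)
    apply mul_left_cancel₀ hc
    simp only [powDiff, Int.cast_sub, Int.cast_prod, Int.cast_pow, Int.cast_natCast, mul_sub,
      ← Finset.prod_mul_distrib, ← pow_add, mul_zero]
    rw [sub_eq_zero]
    convert hf using 3 with i _ i _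
    · simp only [v]
      omega
    · simp only [v]
      omega

/-! ### Chebyshev's bound -/

theorem primeCounting_floor_le {x : ℝ} (hx : 1 < x) :
    (Nat.primeCounting ⌊x⌋₊ : ℝ) ≤ (2 * Real.log 4 + 2) * x / Real.log x := by
  have hlog : 0 < Real.log x := Real.log_pos hx
  have hs : Real.log √x = Real.log x / 2 := Real.log_sqrt (by linarith)
  have h1 := Chebyshev.pi_le_log4_mul_div hx
  have h2 : Real.log √x ≤ √x := Real.log_le_self (Real.sqrt_nonneg x)
  have h3 : √x * √x = x := Real.mul_self_sqrt (by linarith)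
  refine h1.trans ?_
  rw [hs] at h2 ⊢
  have h4 : √x * Real.log x ≤ 2 * x := by nlinarith [Real.sqrt_nonneg x]
  have h5 : √x ≤ 2 * x / Real.log x := by rwa [le_div_iff₀ hlog]
  calc _ ≤ Real.log 4 * x / (Real.log x / 2) + 2 * x / Real.log x := by gcongr
    _ = _ := by field_simp

/-! ### The first `m` primes and `lambdaPrime` -/

/-- The family of the first `m` primes. -/
noncomputable def firstPrimes (m : ℕ) : Fin m → ℕ := fun i => Nat.nth Nat.Prime i

theorem prime_firstPrimes {m : ℕ} (i : Fin m) : (firstPrimes m i).Prime :=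
  Nat.prime_nth_prime i

theorem firstPrimes_injective (m : ℕ) : Function.Injective (firstPrimes m) := fun _ _ h =>
  Fin.ext (Nat.nth_injective Nat.infinite_setOfPred_prime h)

theorem firstPrimes_le_prod {m : ℕ} (i : Fin m) : firstPrimes m i ≤ ∏ j, firstPrimes m j :=
  Finset.single_le_prod' (fun j _ => (prime_firstPrimes j).one_lt.le) (Finset.mem_univ i)

theorem one_le_prod_firstPrimes (m : ℕ) : 1 ≤ ∏ i, firstPrimes m i :=
  Finset.one_le_prod' fun i _ => (prime_firstPrimes i).one_lt.le

theorem natCast_firstPrimes_ne_zero {p m : ℕ} (hp : p.Prime) (i : Fin m)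
    (hi : firstPrimes m i ≠ p) : (firstPrimes m i : ZMod p) ≠ 0 := fun h =>
  hi ((Nat.prime_dvd_prime_iff_eq hp (prime_firstPrimes i)).1
    ((ZMod.natCast_eq_zero_iff _ _).1 h)).symm

theorem lambdaPrime_pos {p m : ℕ} (hp : p.Prime) : 0 < lambdaPrime p m := by
  have : Fact p.Prime := ⟨hp⟩
  refine Nat.pos_of_ne_zero fun h => ?_
  obtain ⟨i, hi, h0⟩ := Finset.lcm_eq_zero_iff.1 h
  simp only [Finset.mem_filter, Finset.mem_range] at hi
  exact (orderOf_pos_iff.2 (isOfFinOrder_iff_isUnit.2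
    (natCast_firstPrimes_ne_zero hp ⟨i, hi.1⟩ hi.2).isUnit)).ne' h0

theorem firstPrimes_pow_lambdaPrime {p m : ℕ} (i : Fin m) (hi : firstPrimes m i ≠ p) :
    (firstPrimes m i : ZMod p) ^ lambdaPrime p m = 1 :=
  orderOf_dvd_iff_pow_eq_one.1 <| Finset.dvd_lcm
    (f := fun i => orderOf ((Nat.nth Nat.Prime i : ℕ) : ZMod p))
    (Finset.mem_filter.2 ⟨Finset.mem_range.2 i.2, hi⟩)

/-! ### Summing over the primes -/

open Classical in
/-- A pointwise bound whose three terms majorize `1 / λ_{p,m}` for small `p`, for large `λ_{p,m}`,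
and for `p` dividing some `powDiff` of a vector of sup norm `h` with `h ^ m ≤ λ_{p,m} < y ^ m`. -/
theorem one_div_lambdaPrime_le {m : ℕ} (hm : 1 ≤ m) {y w : ℝ} (hy : 0 < y)
    (hw : (∏ i, firstPrimes m i : ℕ) ≤ w) {p : ℕ} (hp : p.Prime) :
    1 / (lambdaPrime p m : ℝ) ≤ (if (p : ℝ) ≤ w then 1 else 0) + 1 / y ^ m +
      ∑ h ∈ Finset.Icc 1 ⌊y⌋₊, ∑ v ∈ supShell (Fin m) h,
        if w < p ∧ (p : ℤ) ∣ powDiff (firstPrimes m) v then 1 / (h : ℝ) ^ m else 0 := by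
  have hL : 0 < lambdaPrime p m := lambdaPrime_pos hp
  have hL' : (1 : ℝ) ≤ lambdaPrime p m := by exact_mod_cast hL
  have hsum : 0 ≤ ∑ h ∈ Finset.Icc 1 ⌊y⌋₊, ∑ v ∈ supShell (Fin m) h,
      if w < p ∧ (p : ℤ) ∣ powDiff (firstPrimes m) v then 1 / (h : ℝ) ^ m else 0 :=
    Finset.sum_nonneg fun h _ => Finset.sum_nonneg fun v _ => by split_ifs <;> positivity
  have hy' : 0 < 1 / y ^ m := by positivity
  rcases le_or_gt (p : ℝ) w with hpw | hpw
  · have : 1 / (lambdaPrime p m : ℝ) ≤ 1 := by rw [div_le_one (by linarith)]; exact hL'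
    rw [if_pos hpw]
    linarith
  rw [if_neg hpw.not_ge, zero_add]
  rcases le_or_gt (y ^ m) (lambdaPrime p m : ℝ) with hyL | hyL
  · have := one_div_le_one_div_of_le (by positivity) hyL
    linarith
  have hne (i : Fin m) : firstPrimes m i ≠ p := fun h => by
    have h1 : (firstPrimes m i : ℝ) ≤ (∏ i, firstPrimes m i : ℕ) :=
      Nat.cast_le.2 (firstPrimes_le_prod i)
    rw [h] at h1
    linarith
  have : Nonempty (Fin m) := ⟨⟨0, hm⟩⟩
  obtain ⟨h, h1, hhL, v, hv, hdvd⟩ := exists_dvd_powDiff hp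
    (fun i => natCast_firstPrimes_ne_zero hp i (hne i)) hL
    fun i => firstPrimes_pow_lambdaPrime i (hne i)
  rw [Fintype.card_fin] at hhL
  have hhL' : (h : ℝ) ^ m ≤ lambdaPrime p m := by exact_mod_cast hhL
  have hhy : (h : ℝ) ≤ y :=
    (lt_of_pow_lt_pow_left₀ m hy.le (hhL'.trans_lt hyL)).le
  have hh0 : (0 : ℝ) < h := by exact_mod_cast h1
  have hmem : h ∈ Finset.Icc 1 ⌊y⌋₊ := Finset.mem_Icc.2 ⟨h1, Nat.le_floor hhy⟩
  calc 1 / (lambdaPrime p m : ℝ) ≤ 1 / (h : ℝ) ^ m :=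
        one_div_le_one_div_of_le (by positivity) hhL'
    _ = if w < p ∧ (p : ℤ) ∣ powDiff (firstPrimes m) v then 1 / (h : ℝ) ^ m else 0 :=
        (if_pos ⟨hpw, hdvd⟩).symm
    _ ≤ ∑ v ∈ supShell (Fin m) h,
          if w < p ∧ (p : ℤ) ∣ powDiff (firstPrimes m) v then 1 / (h : ℝ) ^ m else 0 :=
        Finset.single_le_sum (f := fun v =>
          if w < p ∧ (p : ℤ) ∣ powDiff (firstPrimes m) v then 1 / (h : ℝ) ^ m else 0)
          (fun v _ => by split_ifs <;> positivity) hv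
    _ ≤ ∑ h ∈ Finset.Icc 1 ⌊y⌋₊, ∑ v ∈ supShell (Fin m) h,
          if w < p ∧ (p : ℤ) ∣ powDiff (firstPrimes m) v then 1 / (h : ℝ) ^ m else 0 :=
        Finset.single_le_sum (f := fun h : ℕ => ∑ v ∈ supShell (Fin m) h,
          if w < p ∧ (p : ℤ) ∣ powDiff (firstPrimes m) v then 1 / (h : ℝ) ^ m else 0)
          (fun h _ => Finset.sum_nonneg fun v _ => by split_ifs <;> positivity) hmem
    _ ≤ _ := by linarith

/-- The contribution of the vectors of sup norm `h`: there are `O(h ^ (m - 1))` of them, and each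
`powDiff` is at most `(∏ q) ^ h`, so has `O(h / log w)` prime divisors above `w`. The factors of `h`
cancel, which leaves a bound independent of `h`. -/
theorem sum_supShell_card_le {m : ℕ} (hm : 1 ≤ m) {w : ℝ} (hw : 1 < w) {h : ℕ} (hh : 1 ≤ h)
    (s : Finset ℕ) (hs : ∀ p ∈ s, p.Prime) :
    ∑ v ∈ supShell (Fin m) h, ∑ p ∈ s,
      (if w < p ∧ (p : ℤ) ∣ powDiff (firstPrimes m) v then 1 / (h : ℝ) ^ m else 0) ≤
    2 * m * 3 ^ (m - 1) * Real.log (∏ i, firstPrimes m i : ℕ) / Real.log w := by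
  classical
  have hlogw : 0 < Real.log w := Real.log_pos hw
  set Q : ℕ := ∏ i, firstPrimes m i with hQ
  have hlogQ : 0 ≤ Real.log Q := Real.log_natCast_nonneg Q
  have hh0 : (0 : ℝ) < h := by exact_mod_cast hh
  have hterm : ∀ v ∈ supShell (Fin m) h, ∑ p ∈ s,
      (if w < p ∧ (p : ℤ) ∣ powDiff (firstPrimes m) v then 1 / (h : ℝ) ^ m else 0) ≤
      h * Real.log Q / Real.log w * (1 / (h : ℝ) ^ m) := by
    intro v hv
    simp only [supShell, Finset.mem_filter, Fintype.mem_piFinset, Finset.mem_Icc] at hv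
    obtain ⟨hv, i, hi⟩ := hv
    have hv0 : v ≠ 0 := by
      rintro rfl
      simp at hi
      omega
    have hn := powDiff_ne_zero prime_firstPrimes (firstPrimes_injective m) hv0
    have hn' : |(powDiff (firstPrimes m) v : ℝ)| ≤ (Q : ℝ) ^ h := by
      exact_mod_cast abs_powDiff_le (fun i => (prime_firstPrimes i).one_lt.le)
        fun i => abs_le.2 (hv i)
    have hlog := (card_mul_log_le_log_abs hn hw
      (s := s.filter fun p : ℕ => w < p ∧ (p : ℤ) ∣ powDiff (firstPrimes m) v)
      fun p hp => ⟨hs p (Finset.mem_filter.1 hp).1, (Finset.mem_filter.1 hp).2⟩).trans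
      (Real.log_le_log (abs_pos.2 (Int.cast_ne_zero.2 hn)) hn')
    rw [Real.log_pow, ← le_div_iff₀ hlogw] at hlog
    rw [← Finset.sum_filter, Finset.sum_const, nsmul_eq_mul]
    gcongr
  have hcard : ((supShell (Fin m) h).card : ℝ) ≤ m * (2 * (3 * h) ^ (m - 1)) := by
    have h1 := card_supShell_le (ι := Fin m) h
    rw [Fintype.card_fin] at h1
    have h2 : m * (2 * (2 * h + 1) ^ (m - 1)) ≤ m * (2 * (3 * h) ^ (m - 1)) := by
      gcongr
      omega
    exact_mod_cast h1.trans h2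
  calc _ ≤ (supShell (Fin m) h).card • (h * Real.log Q / Real.log w * (1 / (h : ℝ) ^ m)) :=
        Finset.sum_le_card_nsmul _ _ _ hterm
    _ ≤ m * (2 * (3 * h) ^ (m - 1)) * (h * Real.log Q / Real.log w * (1 / (h : ℝ) ^ m)) := by
        rw [nsmul_eq_mul]
        gcongr
    _ = _ := by
        obtain ⟨k, rfl⟩ := Nat.exists_eq_add_of_le' hm
        simp only [Nat.add_sub_cancel, mul_pow, pow_succ]
        field_simp

/-- The `θ`-free estimate behind the theorem: the full sum of `1 / λ_{p,m}` over the primes up to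
`x`. -/
theorem exists_sum_one_div_lambdaPrime_le {m : ℕ} (hm : 1 ≤ m) :
    ∃ C : ℝ, 0 < C ∧ ∀ x : ℝ, 2 ≤ x →
      ∑ p ∈ (Finset.Icc 1 ⌊x⌋₊).filter Nat.Prime, 1 / (lambdaPrime p m : ℝ) ≤
        C * (x ^ (1 / ((m : ℝ) + 1)) / Real.log x) := by
  set Q : ℕ := ∏ i, firstPrimes m i with hQ
  have hQ1 : (1 : ℝ) ≤ Q := by exact_mod_cast one_le_prod_firstPrimes m
  have hlogQ : 0 ≤ Real.log Q := Real.log_natCast_nonneg Q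
  set D : ℝ := 2 * m * 3 ^ (m - 1) * Real.log Q with hD
  have hD0 : 0 ≤ D := by positivity
  have hlog4 : 0 < Real.log 4 := Real.log_pos (by norm_num)
  refine ⟨Q * (2 * (m + 1)) + (2 * Real.log 4 + 2) + D * (2 * (m + 1)), by positivity, ?_⟩
  intro x hx
  have hlogx : 0 < Real.log x := Real.log_pos (by linarith)
  set y : ℝ := x ^ (1 / ((m : ℝ) + 1)) with hy
  have hy1 : 1 < y := Real.one_lt_rpow (by linarith) (by positivity)
  have hyx : y ^ m * y = x := by
    rw [← pow_succ, hy, ← Real.rpow_natCast, ← Real.rpow_mul (by linarith)]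
    push_cast
    rw [one_div_mul_cancel (by positivity), Real.rpow_one]
  have hs1 : 1 < √y := Real.lt_sqrt_of_sq_lt (by simpa using hy1)
  have hlogs : Real.log √y = Real.log x / (2 * (m + 1)) := by
    rw [Real.log_sqrt (by linarith), hy, Real.log_rpow (by linarith)]
    field_simp
  have hlogs0 : 0 < Real.log √y := Real.log_pos hs1
  -- The cut-off exceeds `√y`, so that its logarithm is comparable to `log x`, and exceeds `Q`.
  set w : ℝ := Q * √y with hw
  have hws : √y ≤ w := le_mul_of_one_le_left (by positivity) hQ1
  have hwQ : (Q : ℝ) ≤ w := le_mul_of_one_le_right (by positivity) hs1.le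
  set s := (Finset.Icc 1 ⌊x⌋₊).filter Nat.Prime with hs
  have hsprime : ∀ p ∈ s, p.Prime := fun p hp => (Finset.mem_filter.1 hp).2
  have hsmall : ∑ p ∈ s, (if (p : ℝ) ≤ w then (1 : ℝ) else 0) ≤
      Q * (2 * (m + 1)) * (y / Real.log x) := by
    have hcard : (s.filter fun p : ℕ => (p : ℝ) ≤ w).card ≤ ⌊w⌋₊ := by
      rw [← Nat.add_sub_cancel (n := ⌊w⌋₊) (m := 1), ← Nat.card_Icc]
      refine Finset.card_le_card fun p hp => ?_
      rw [Finset.mem_filter] at hp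
      exact Finset.mem_Icc.2 ⟨(hsprime p hp.1).one_lt.le, Nat.le_floor hp.2⟩
    have hsy : √y ≤ 2 * (m + 1) * (y / Real.log x) := by
      have h1 := Real.log_le_self (Real.sqrt_nonneg y)
      have h2 : √y * √y = y := Real.mul_self_sqrt (by linarith)
      rw [hlogs, div_le_iff₀ (by positivity)] at h1
      rw [← mul_div_assoc, le_div_iff₀ hlogx]
      calc √y * Real.log x ≤ √y * (√y * (2 * (m + 1))) := by gcongr
        _ = 2 * (m + 1) * (√y * √y) := by ring
        _ = 2 * (m + 1) * y := by rw [h2]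
    rw [← Finset.sum_filter, Finset.sum_const, nsmul_eq_mul, mul_one]
    calc ((s.filter fun p : ℕ => (p : ℝ) ≤ w).card : ℝ) ≤ ⌊w⌋₊ := by exact_mod_cast hcard
      _ ≤ w := Nat.floor_le (by positivity)
      _ ≤ Q * (2 * (m + 1) * (y / Real.log x)) := by rw [hw]; gcongr
      _ = _ := by ring
  have hlarge : ∑ _p ∈ s, 1 / y ^ m ≤ (2 * Real.log 4 + 2) * (y / Real.log x) := by
    have hcard : s.card ≤ Nat.primeCounting ⌊x⌋₊ := by
      rw [Nat.primeCounting, Nat.primeCounting', Nat.count_eq_card_filter_range]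
      refine Finset.card_le_card fun p hp => ?_
      simp only [hs, Finset.mem_filter, Finset.mem_Icc, Finset.mem_range] at hp ⊢
      exact ⟨by omega, hp.2⟩
    have hπ : (s.card : ℝ) ≤ (2 * Real.log 4 + 2) * x / Real.log x :=
      (Nat.cast_le.2 hcard).trans (primeCounting_floor_le (by linarith))
    rw [Finset.sum_const, nsmul_eq_mul]
    calc (s.card : ℝ) * (1 / y ^ m) ≤ (2 * Real.log 4 + 2) * x / Real.log x * (1 / y ^ m) := by
          gcongr
      _ = _ := by
          rw [← hyx]
          field_simp
  classical
  have hmiddle : ∑ p ∈ s, ∑ h ∈ Finset.Icc 1 ⌊y⌋₊, ∑ v ∈ supShell (Fin m) h,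
      (if w < p ∧ (p : ℤ) ∣ powDiff (firstPrimes m) v then 1 / (h : ℝ) ^ m else 0) ≤
      D * (2 * (m + 1)) * (y / Real.log x) := by
    rw [Finset.sum_comm]
    have hterm : ∀ h ∈ Finset.Icc 1 ⌊y⌋₊, ∑ p ∈ s, ∑ v ∈ supShell (Fin m) h,
        (if w < p ∧ (p : ℤ) ∣ powDiff (firstPrimes m) v then 1 / (h : ℝ) ^ m else 0) ≤
        D / Real.log √y := by
      intro h hh
      rw [Finset.sum_comm]
      refine (sum_supShell_card_le hm (hs1.trans_le hws) (Finset.mem_Icc.1 hh).1 s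
        hsprime).trans ?_
      rw [← hQ, ← hD]
      gcongr
    refine (Finset.sum_le_card_nsmul _ _ _ hterm).trans ?_
    rw [Nat.card_Icc, Nat.add_sub_cancel, nsmul_eq_mul]
    calc (⌊y⌋₊ : ℝ) * (D / Real.log √y) ≤ y * (D / Real.log √y) := by
          gcongr
          exact Nat.floor_le (by linarith)
      _ = _ := by
          rw [hlogs]
          field_simp
  calc ∑ p ∈ s, 1 / (lambdaPrime p m : ℝ)
      ≤ ∑ p ∈ s, ((if (p : ℝ) ≤ w then (1 : ℝ) else 0) + 1 / y ^ m +
        ∑ h ∈ Finset.Icc 1 ⌊y⌋₊, ∑ v ∈ supShell (Fin m) h,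
          if w < p ∧ (p : ℤ) ∣ powDiff (firstPrimes m) v then 1 / (h : ℝ) ^ m else 0) :=
        Finset.sum_le_sum fun p hp => by
          convert one_div_lambdaPrime_le (y := y) hm (by linarith) hwQ (hsprime p hp)
    _ ≤ _ := by
        rw [Finset.sum_add_distrib, Finset.sum_add_distrib, add_mul, add_mul]
        exact add_le_add (add_le_add hsmall hlarge) hmiddle

theorem mainTheorem4 (m : ℕ) (hm : 1 ≤ m) :
    ∃ C : ℝ, 0 < C ∧ ∀ θ : ℝ, 0 < θ → θ < 1 → ∀ x : ℝ, 2 ≤ x →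
      ∑ p ∈ (Finset.Icc 1 ⌊x⌋₊).filter (fun p : ℕ => p.Prime ∧ x ^ θ < (p : ℝ)),
          1 / ((p : ℝ) * (lambdaPrime p m : ℝ))
        ≤ C * (1 / (x ^ (θ - 1 / ((m : ℝ) + 1)) * Real.log x)) := by
  obtain ⟨C, hC, hsum⟩ := exists_sum_one_div_lambdaPrime_le hm
  refine ⟨C, hC, fun θ _ _ x hx => ?_⟩
  have hx0 : 0 < x := by linarith
  have hθ : 0 < x ^ θ := Real.rpow_pos_of_pos hx0 θ
  calc _ ≤ ∑ p ∈ (Finset.Icc 1 ⌊x⌋₊).filter (fun p : ℕ => p.Prime ∧ x ^ θ < (p : ℝ)),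
        1 / x ^ θ * (1 / (lambdaPrime p m : ℝ)) := by
        refine Finset.sum_le_sum fun p hp => ?_
        rw [one_div_mul_eq_div, one_div, mul_inv, div_eq_inv_mul, one_div]
        have := (Finset.mem_filter.1 hp).2.2.le
        gcongr
    _ ≤ ∑ p ∈ (Finset.Icc 1 ⌊x⌋₊).filter Nat.Prime,
        1 / x ^ θ * (1 / (lambdaPrime p m : ℝ)) :=
        Finset.sum_le_sum_of_subset_of_nonneg
          (Finset.monotone_filter_right _ fun _ _ h => h.1) fun p _ _ => by positivity
    _ ≤ 1 / x ^ θ * (C * (x ^ (1 / ((m : ℝ) + 1)) / Real.log x)) := by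
        rw [← Finset.mul_sum]
        gcongr
        exact hsum x hx
    _ = _ := by
        rw [Real.rpow_sub hx0]
        field_simp
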